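/- Let $X$ be a universally complete (real) vector lattice, that is, every non-empty subset of $X$ that is bounded above has a supremum, and every non-empty set of pairwise disjoint positive elements of $X$ has a supremum. Then $X$ is unbounded order complete: every uo-Cauchy net in $X$ is uo-convergent to some element of $X$. Here a net $(x_\alpha)_{\alpha\in A}$ (indexed by a non-empty directed preordered set $A$) is order convergent to $x$, written $x_\alpha\xrightarrow{o}x$, if there is a net $(y_\gamma)_{\gamma\in\Gamma}$ in $X$ with $y_\gamma\downarrow 0$ such that for every $\gamma\in\Gamma$ there is $\alpha_0\in A$ with $|x_\alpha-x|\le y_\gamma$ for all $\alpha\ge\alpha_0$. The net is uo-convergent to $x$ if $|x_\alpha-x|\wedge u\xrightarrow{o}0$ for every $u\in X_+$. It is uo-Cauchy if the double net $(x_\alpha-x_\beta)_{(\alpha,\beta)\in A\times A}$ is uo-convergent to $0$. -/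

import Mathlib

universe u v w

/-- Order convergence of a net in a vector lattice: there is a net `y` with `y ↓ 0` such that every
`y γ` eventually dominates `|x α - l|`. The index set `Γ` of the dominating net is taken in the
universe of `X`; this loses nothing, see `OrderConvergesTo.of_dominating`. -/
def OrderConvergesTo {X : Type u} [AddCommGroup X] [Lattice X]
    {A : Type v} [Preorder A] (x : A → X) (l : X) : Prop :=
  ∃ (Γ : Type u) (_ : Preorder Γ) (_ : IsDirectedOrder Γ) (_ : Nonempty Γ) (y : Γ → X),
    Antitone y ∧ IsGLB (Set.range y) 0 ∧
      ∀ γ : Γ, ∃ α₀ : A, ∀ α : A, α₀ ≤ α → |x α - l| ≤ y γ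

/-- A dominating net indexed in any universe witnesses order convergence. -/
theorem OrderConvergesTo.of_dominating {X : Type u} [AddCommGroup X] [Lattice X]
    {A : Type v} [Preorder A] {x : A → X} {l : X}
    {Γ : Type w} [Preorder Γ] [IsDirectedOrder Γ] [Nonempty Γ] {y : Γ → X}
    (hy : Antitone y) (h0 : IsGLB (Set.range y) 0)
    (h : ∀ γ : Γ, ∃ α₀ : A, ∀ α : A, α₀ ≤ α → |x α - l| ≤ y γ) : OrderConvergesTo x l := by
  refine ⟨(Set.range y)ᵒᵈ, inferInstance, ⟨?_⟩, ?_, fun z => (OrderDual.ofDual z).1, ?_, ?_, ?_⟩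
  · rintro ⟨_, γ₁, rfl⟩ ⟨_, γ₂, rfl⟩
    obtain ⟨γ, h₁, h₂⟩ := exists_ge_ge γ₁ γ₂
    exact ⟨OrderDual.toDual ⟨y γ, γ, rfl⟩, hy h₁, hy h₂⟩
  · exact ⟨OrderDual.toDual ⟨_, Classical.arbitrary Γ, rfl⟩⟩
  · exact fun a b hab => hab
  · convert h0 using 1
    ext z
    constructor
    · rintro ⟨⟨_, γ, rfl⟩, rfl⟩
      exact ⟨γ, rfl⟩
    · rintro ⟨γ, rfl⟩
      exact ⟨OrderDual.toDual ⟨y γ, γ, rfl⟩, rfl⟩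
  · rintro ⟨_, γ, rfl⟩
    exact h γ

/-- Unbounded order (uo) convergence of a net. -/
def UOConvergesTo {X : Type u} [AddCommGroup X] [Lattice X]
    {A : Type v} [Preorder A] (x : A → X) (l : X) : Prop :=
  ∀ w : X, 0 ≤ w → OrderConvergesTo (fun α => |x α - l| ⊓ w) 0

/-- A net `x` is uo-Cauchy if the double net `x α - x β`, indexed by `A × A` with the product
order, is uo-convergent to `0`. -/
def UOCauchy {X : Type u} [AddCommGroup X] [Lattice X]
    {A : Type v} [Preorder A] (x : A → X) : Prop :=
  UOConvergesTo (fun p : A × A => x p.1 - x p.2) 0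

/-- Every uo-Cauchy net (with index set in `Type v`) is uo-convergent. -/
def UOComplete (X : Type u) [AddCommGroup X] [Lattice X] : Prop :=
  ∀ (A : Type v) [Preorder A] [IsDirectedOrder A] [Nonempty A] (x : A → X),
    UOCauchy x → ∃ l : X, UOConvergesTo x l

/-- Every non-empty subset that is bounded above has a supremum. -/
def DedekindComplete (X : Type u) [Lattice X] : Prop :=
  ∀ S : Set X, S.Nonempty → BddAbove S → ∃ a : X, IsLUB S a

/-- Every non-empty set of pairwise disjoint positive elements has a supremum. -/
def LaterallyComplete (X : Type u) [AddCommGroup X] [Lattice X] : Prop :=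
  ∀ S : Set X, S.Nonempty → (∀ a ∈ S, 0 ≤ a) → (∀ a ∈ S, ∀ b ∈ S, a ≠ b → a ⊓ b = 0) →
    ∃ a : X, IsLUB S a

/-- Universally complete: Dedekind complete and laterally complete. -/
def UniversallyComplete (X : Type u) [AddCommGroup X] [Lattice X] : Prop :=
  DedekindComplete X ∧ LaterallyComplete X

/-! Positive and negative parts are contractions, so it suffices to treat positive nets. The limit
is then the lower limit: the supremum of the infima of the tails. Dedekind completeness gives those
infima; the difficulty is to bound them above. The Cauchy condition bounds them on some band inside
any given nonzero band. `bddAbove_of_majorizedOn` glues such local bounds along a maximal disjoint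
family, using lateral completeness. Cauchy estimates then pass to the limit because meets distribute
over suprema. -/

/-- A net decreasing to zero that dominates the truncated differences of a uo-Cauchy net. -/
theorem UOCauchy.exists_dominating {X : Type u} [AddCommGroup X] [Lattice X] {A : Type v}
    [Preorder A] [IsDirectedOrder A] {x : A → X} (hx : UOCauchy x) {w : X} (hw : 0 ≤ w) :
    ∃ (Γ : Type u) (_ : Preorder Γ) (_ : IsDirectedOrder Γ) (_ : Nonempty Γ) (y : Γ → X),
      Antitone y ∧ IsGLB (Set.range y) 0 ∧
        ∀ γ : Γ, ∃ α₀ : A, ∀ α, α₀ ≤ α → ∀ β, α₀ ≤ β → |x α - x β| ⊓ w ≤ y γ := by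
  obtain ⟨Γ, i₁, i₂, i₃, y, hy, h0, h⟩ := hx w hw
  refine ⟨Γ, i₁, i₂, i₃, y, hy, h0, fun γ => ?_⟩
  obtain ⟨⟨a, b⟩, hab⟩ := h γ
  obtain ⟨c, hac, hbc⟩ := exists_ge_ge a b
  refine ⟨c, fun α hα β hβ => ?_⟩
  have h1 := hab (α, β) ⟨hac.trans hα, hbc.trans hβ⟩
  simp only [sub_zero] at h1
  exact (le_abs_self _).trans h1

section LatticeOrderedGroup

variable {X : Type u} [AddCommGroup X] [Lattice X] [IsOrderedAddMonoid X]

/-! ### Disjointness and the Archimedean property -/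

theorem add_inf_le_inf_add_inf {a b c : X} (ha : 0 ≤ a) (hb : 0 ≤ b) (hc : 0 ≤ c) :
    (a + b) ⊓ c ≤ a ⊓ c + b ⊓ c := by
  rw [add_inf, inf_add, inf_add]
  refine le_inf (le_inf inf_le_left ?_) (le_inf ?_ ?_)
  · exact inf_le_right.trans (le_add_of_nonneg_right hb)
  · exact inf_le_right.trans (le_add_of_nonneg_left ha)
  · exact inf_le_right.trans (le_add_of_nonneg_left hc)

theorem nsmul_inf_eq_zero {a b : X} (ha : 0 ≤ a) (hb : 0 ≤ b) (h : a ⊓ b = 0) (n : ℕ) :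
    (n • a) ⊓ b = 0 := by
  induction n with
  | zero => simpa using hb
  | succ n ih =>
    refine le_antisymm ?_ (le_inf (nsmul_nonneg ha _) hb)
    rw [succ_nsmul]
    refine (add_inf_le_inf_add_inf (nsmul_nonneg ha n) ha hb).trans ?_
    rw [ih, h, add_zero]

/-- Finite infima distribute over arbitrary suprema, in the form of an upper bound. -/
theorem IsLUB.inf_le_of_forall_inf_le {S : Set X} {a c y : X} (ha : IsLUB S a)
    (h : ∀ s ∈ S, s ⊓ c ≤ y) : a ⊓ c ≤ y := by
  have h1 : a ≤ y + (a ⊔ c) - c := by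
    refine ha.2 fun s hs => ?_
    have h2 : s ⊓ c + s ⊔ c = s + c := inf_add_sup s c
    rw [eq_sub_of_add_eq h2.symm]
    exact sub_le_sub_right (add_le_add (h s hs) (sup_le_sup_right (ha.1 hs) c)) c
  rw [eq_sub_of_add_eq (inf_add_sup a c), sub_le_iff_le_add, ← le_sub_iff_add_le]
  exact h1

theorem sub_inf_eq_posPart (a b : X) : a - b ⊓ a = (a - b)⁺ := by
  rw [posPart_def, sub_inf, sub_self]

theorem posPart_sub_inf_posPart_sub (a b : X) : (a - b)⁺ ⊓ (b - a)⁺ = 0 := by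
  have h := posPart_inf_negPart_eq_zero (a - b)
  rwa [← posPart_neg, neg_sub] at h

/-- Shifting the sequence of multiples by one shows that its supremum `s` satisfies `s ≤ s - z`. -/
theorem nonpos_of_forall_nsmul_le (hX : DedekindComplete X) {z x : X}
    (h : ∀ n : ℕ, n • z ≤ x) : z ≤ 0 := by
  obtain ⟨s, hs⟩ := hX (Set.range fun n : ℕ => n • z) (Set.range_nonempty _)
    ⟨x, by rintro _ ⟨n, rfl⟩; exact h n⟩
  have h1 : s ≤ s - z := by
    refine hs.2 ?_
    rintro _ ⟨n, rfl⟩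
    rw [le_sub_iff_add_le, ← succ_nsmul]
    exact hs.1 ⟨n + 1, rfl⟩
  simpa using h1

/-- For `0 ≤ x`, the elements `(x - n • u)⁺ ⊓ u` have infimum zero. -/
theorem eq_zero_of_forall_le_posPart_sub_nsmul (hX : DedekindComplete X) {z u x : X}
    (hx : 0 ≤ x) (hz : 0 ≤ z) (hzu : z ≤ u) (h : ∀ n : ℕ, z ≤ (x - n • u)⁺) : z = 0 := by
  refine le_antisymm (nonpos_of_forall_nsmul_le hX (x := x) fun n => ?_) hz
  have h1 : z ≤ (x - n • z)⁺ :=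
    (h n).trans (posPart_mono (sub_le_sub_left (nsmul_le_nsmul_right hzu n) x))
  -- Then `n • z` is also disjoint from `(n • z - x)⁺`, which lies below it and so must vanish.
  have h2 : z ⊓ (n • z - x)⁺ = 0 :=
    le_antisymm ((inf_le_inf_right _ h1).trans (posPart_sub_inf_posPart_sub _ _).le)
      (le_inf hz (posPart_nonneg _))
  have h3 := nsmul_inf_eq_zero hz (posPart_nonneg _) h2 n
  have h4 : (n • z - x)⁺ ≤ n • z :=
    sup_le (sub_le_self _ hx) (nsmul_nonneg hz n)
  rw [inf_eq_right.2 h4, posPart_eq_zero] at h3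
  exact sub_nonpos.1 h3

/-! ### Gluing local bounds -/

/-- `D` is majorized by some `b` on the band generated by the positive element `v`. -/
def MajorizedOn (D : Set X) (v : X) : Prop :=
  0 ≤ v ∧ ∃ b : X, 0 ≤ b ∧ ∀ d ∈ D, v ⊓ (d - b)⁺ = 0

/-- In a universally complete vector lattice, a set of positive elements that is majorized on an
order dense set of bands is bounded above. -/
theorem bddAbove_of_majorizedOn (hX : UniversallyComplete X) {D : Set X} (hne : D.Nonempty)
    (hD : ∀ d ∈ D, 0 ≤ d)
    (h : ∀ w : X, 0 ≤ w → w ≠ 0 → ∃ v, v ≤ w ∧ v ≠ 0 ∧ MajorizedOn D v) : BddAbove D := by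
  -- This supremum is that of the projections of `D` onto the band generated by `v`.
  have hsup : ∀ v : X, MajorizedOn D v →
      ∃ s, IsLUB {t : X | ∃ d ∈ D, ∃ k : ℕ, t = d ⊓ k • v} s := by
    rintro v ⟨hv, b, hb, hvb⟩
    obtain ⟨d₀, hd₀⟩ := hne
    refine hX.1 _ ⟨_, d₀, hd₀, 0, rfl⟩ ⟨b, ?_⟩
    rintro _ ⟨d, hd, k, rfl⟩
    have hkv : 0 ≤ k • v := nsmul_nonneg hv k
    have h1 : d ≤ b + (d - b)⁺ := by
      rw [← sub_le_iff_le_add']; exact le_posPart _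
    refine (inf_le_inf_right _ h1).trans
      ((add_inf_le_inf_add_inf hb (posPart_nonneg _) hkv).trans ?_)
    rw [inf_comm (d - b)⁺, nsmul_inf_eq_zero hv (posPart_nonneg _) (hvb d hd) k, add_zero]
    exact inf_le_left
  choose! f hf using hsup
  have hf0 : ∀ v, MajorizedOn D v → 0 ≤ f v := fun v hv => by
    obtain ⟨d₀, hd₀⟩ := hne
    exact (le_inf (hD d₀ hd₀) (nsmul_nonneg hv.1 0)).trans ((hf v hv).1 ⟨d₀, hd₀, 0, rfl⟩)
  obtain ⟨M, h0M, hM⟩ := zorn_subset_nonempty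
    {M : Set X | (∀ v ∈ M, MajorizedOn D v) ∧ ∀ v ∈ M, ∀ v' ∈ M, v ≠ v' → v ⊓ v' = 0}
    (by
      intro c hc hchain _
      refine ⟨⋃₀ c, ⟨?_, ?_⟩, fun s hs => Set.subset_sUnion_of_mem hs⟩
      · rintro v ⟨s, hs, hvs⟩
        exact (hc hs).1 v hvs
      · rintro v ⟨s, hs, hvs⟩ v' ⟨s', hs', hvs'⟩ hne
        rcases hchain.total hs hs' with hss | hss
        · exact (hc hs').2 v (hss hvs) v' hvs' hne
        · exact (hc hs).2 v hvs v' (hss hvs') hne)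
    -- Starting from `{0}` makes `M` non-empty, as lateral completeness requires.
    {0} ⟨by
      rintro _ rfl
      exact ⟨le_rfl, 0, le_rfl, fun d _ => inf_eq_left.2 (posPart_nonneg _)⟩, by
      rintro _ rfl _ rfl hne
      exact absurd rfl hne⟩
  obtain ⟨hMD, hMdisj⟩ := hM.prop
  obtain ⟨s, hs⟩ := hX.2 (f '' M) ⟨_, 0, h0M rfl, rfl⟩
    (by rintro _ ⟨v, hv, rfl⟩; exact hf0 v (hMD v hv))
    (by
      rintro _ ⟨v, hv, rfl⟩ _ ⟨v', hv', rfl⟩ hne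
      have hvv : v ⊓ v' = 0 := hMdisj v hv v' hv' fun h => hne (congrArg f h)
      have hv0 := (hMD v hv).1
      have hv0' := (hMD v' hv').1
      refine le_antisymm ?_ (le_inf (hf0 v (hMD v hv)) (hf0 v' (hMD v' hv')))
      refine (hf v (hMD v hv)).inf_le_of_forall_inf_le ?_
      rintro _ ⟨d, -, k, rfl⟩
      rw [inf_comm]
      refine (hf v' (hMD v' hv')).inf_le_of_forall_inf_le ?_
      rintro _ ⟨d', -, k', rfl⟩
      refine (inf_le_inf inf_le_right inf_le_right).trans ?_
      refine (nsmul_inf_eq_zero hv0' (nsmul_nonneg hv0 k) ?_ k').le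
      rw [inf_comm]
      exact nsmul_inf_eq_zero hv0 hv0' hvv k)
  refine ⟨s, fun d hd => ?_⟩
  by_contra hds
  have hr : (d - s)⁺ ≠ 0 := by rwa [Ne, posPart_eq_zero, sub_nonpos]
  obtain ⟨w, hwr, hw0, hw⟩ := h _ (posPart_nonneg _) hr
  have hdisj : ∀ v ∈ M, w ⊓ v = 0 := fun v hv => by
    -- Since `s` dominates every `d ⊓ n • v`, `(d - s)⁺` lies below `d - d ⊓ n • v = (d - n • v)⁺`.
    refine eq_zero_of_forall_le_posPart_sub_nsmul hX.1 (hD d hd) (le_inf hw.1 (hMD v hv).1)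
      inf_le_right fun n => ?_
    refine inf_le_left.trans (hwr.trans ?_)
    have h1 : d ⊓ n • v ≤ s :=
      ((hf v (hMD v hv)).1 ⟨d, hd, n, rfl⟩).trans (hs.1 ⟨v, hv, rfl⟩)
    rw [← sub_inf_eq_posPart d (n • v), inf_comm]
    exact sup_le (sub_le_sub_left h1 d) (sub_nonneg.2 inf_le_left)
  have hwM : w ∈ M := by
    refine hM.le_of_ge (y := insert w M) ⟨?_, ?_⟩ (Set.subset_insert _ _) (Set.mem_insert _ _)
    · rintro v (rfl | hv)
      exacts [hw, hMD v hv]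
    · rintro v (rfl | hv) v' (rfl | hv') hne
      · exact absurd rfl hne
      · exact hdisj v' hv'
      · rw [inf_comm]; exact hdisj v hv
      · exact hMdisj v hv v' hv' hne
  exact hw0 (by simpa using hdisj w hwM)

/-! ### The lower limit and the Cauchy estimates -/

/-- If the tails of a positive net `x` have small oscillation locally, then its lower limit `l`
exists, and every eventual bound on `|x α - x β| ⊓ w` is one on `|x α - l| ⊓ w`. -/
theorem exists_forall_abs_sub_inf_le (hX : UniversallyComplete X) {A : Type v} [Preorder A]
    [IsDirectedOrder A] [Nonempty A] {x : A → X} (hx0 : ∀ α, 0 ≤ x α)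
    (hx : ∀ w : X, 0 ≤ w → w ≠ 0 → ∃ y : X, 0 ≤ y ∧ ¬ w ≤ y ∧
      ∃ α₀ : A, ∀ α, α₀ ≤ α → ∀ β, α₀ ≤ β → |x α - x β| ⊓ w ≤ y) :
    ∃ l : X, ∀ (w y : X) (α₀ : A),
      (∀ α, α₀ ≤ α → ∀ β, α₀ ≤ β → |x α - x β| ⊓ w ≤ y) →
        ∀ α, α₀ ≤ α → |x α - l| ⊓ w ≤ y := by
  have hinf : ∀ γ : A, ∃ m, IsLUB (lowerBounds (x '' Set.Ici γ)) m := fun γ =>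
    hX.1 _ ⟨0, by rintro _ ⟨β, -, rfl⟩; exact hx0 β⟩
      ⟨x γ, fun z hz => hz ⟨γ, Set.self_mem_Ici, rfl⟩⟩
  choose m hm using hinf
  have hm_le : ∀ γ β, γ ≤ β → m γ ≤ x β := fun γ β hγβ =>
    (hm γ).2 fun z hz => hz ⟨β, hγβ, rfl⟩
  have hbdd : BddAbove (Set.range m) := by
    refine bddAbove_of_majorizedOn hX (Set.range_nonempty _) ?_ fun w hw hw0 => ?_
    · rintro _ ⟨γ, rfl⟩
      refine (hm γ).1 ?_
      rintro _ ⟨β, -, rfl⟩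
      exact hx0 β
    · obtain ⟨y, hy, hwy, α₀, hα₀⟩ := hx w hw hw0
      -- Where `y` is below `w`, the bound `(m δ - x α₀) ⊓ w ≤ y` forces `m δ - x α₀ ≤ w`.
      refine ⟨(w - y)⁺, sup_le (sub_le_self _ hy) hw, ?_, posPart_nonneg _, x α₀ + w,
        add_nonneg (hx0 _) hw, ?_⟩
      · rwa [Ne, posPart_eq_zero, sub_nonpos]
      · rintro _ ⟨δ, rfl⟩
        obtain ⟨β, hδβ, hβ⟩ := exists_ge_ge δ α₀
        have h1 : (m δ - x α₀) ⊓ w ≤ y :=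
          (inf_le_inf_right _ ((sub_le_sub_right (hm_le δ β hδβ) _).trans
            (le_abs_self _))).trans (hα₀ β hβ α₀ le_rfl)
        have h2 : (w - y)⁺ ≤ (w - (m δ - x α₀))⁺ := by
          rw [← sub_inf_eq_posPart w (m δ - x α₀)]
          exact sup_le (sub_le_sub_left h1 w) (sub_nonneg.2 inf_le_right)
        refine le_antisymm ?_ (le_inf (posPart_nonneg _) (posPart_nonneg _))
        rw [← sub_sub]
        exact (inf_le_inf_right _ h2).trans (posPart_sub_inf_posPart_sub _ _).le
  obtain ⟨l, hl⟩ := hX.1 _ (Set.range_nonempty m) hbdd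
  let _ : DistribLattice X := AddCommGroup.toDistribLattice X
  refine ⟨l, fun w y α₀ h α hα => ?_⟩
  rw [abs, inf_sup_right]
  refine sup_le ?_ ?_
  -- Here `x α - l ≤ x α - m α₀`, a supremum of differences within the tail.
  · have h1 : IsLUB ((fun z => x α - z) '' (x '' Set.Ici α₀)) (x α - m α₀) := by
      constructor
      · rintro _ ⟨_, ⟨β, hβ, rfl⟩, rfl⟩
        exact sub_le_sub_left (hm_le α₀ β hβ) _
      · intro b hb
        rw [sub_le_comm]
        refine (hm α₀).1 ?_
        rintro _ ⟨β, hβ, rfl⟩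
        rw [sub_le_comm]
        exact hb ⟨_, ⟨β, hβ, rfl⟩, rfl⟩
    refine (inf_le_inf_right _ (sub_le_sub_left (hl.1 ⟨α₀, rfl⟩) (x α))).trans
      (h1.inf_le_of_forall_inf_le ?_)
    rintro _ ⟨_, ⟨β, hβ, rfl⟩, rfl⟩
    exact (inf_le_inf_right _ (le_abs_self _)).trans (h α hα β hβ)
  · have h1 : IsLUB ((fun z => z - x α) '' Set.range m) (l - x α) := by
      constructor
      · rintro _ ⟨z, hz, rfl⟩
        exact sub_le_sub_right (hl.1 hz) _
      · intro b hb
        rw [sub_le_iff_le_add]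
        refine hl.2 fun z hz => ?_
        rw [← sub_le_iff_le_add]
        exact hb ⟨z, hz, rfl⟩
    rw [neg_sub]
    refine h1.inf_le_of_forall_inf_le ?_
    rintro _ ⟨_, ⟨δ, rfl⟩, rfl⟩
    -- The index `δ` need not lie beyond `α₀`, but `m δ` is below `x β` for some `β` that does.
    obtain ⟨β, hδβ, hβ⟩ := exists_ge_ge δ α₀
    exact (inf_le_inf_right _ ((sub_le_sub_right (hm_le δ β hδβ) _).trans
      (le_abs_self _))).trans (h β hβ α hα)

theorem abs_posPart_sub_posPart_le (a b : X) : |a⁺ - b⁺| ≤ |a - b| :=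
  abs_sup_sub_sup_le_abs a b 0

theorem abs_negPart_sub_negPart_le (a b : X) : |a⁻ - b⁻| ≤ |a - b| := by
  rw [← posPart_neg, ← posPart_neg]
  refine (abs_posPart_sub_posPart_le _ _).trans_eq ?_
  rw [← abs_neg, neg_sub_neg, neg_sub]

/-- The image of a uo-Cauchy net under a positive contraction `p` has a limit `l` such that every
eventual bound on `|x α - x β| ⊓ w` is one on `|p (x α) - l| ⊓ w`. -/
theorem UOCauchy.exists_forall_abs_sub_inf_le (hX : UniversallyComplete X) {A : Type v}
    [Preorder A] [IsDirectedOrder A] [Nonempty A] {x : A → X} (hx : UOCauchy x) {p : X → X}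
    (hp0 : ∀ a, 0 ≤ p a) (hp : ∀ a b, |p a - p b| ≤ |a - b|) :
    ∃ l : X, ∀ (w y : X) (α₀ : A),
      (∀ α, α₀ ≤ α → ∀ β, α₀ ≤ β → |x α - x β| ⊓ w ≤ y) →
        ∀ α, α₀ ≤ α → |p (x α) - l| ⊓ w ≤ y := by
  obtain ⟨l, hl⟩ := _root_.exists_forall_abs_sub_inf_le hX (x := p ∘ x) (fun α => hp0 _)
    (fun w hw hw0 => by
      obtain ⟨Γ, _, _, _, y, -, h0, h⟩ := hx.exists_dominating hw
      obtain ⟨γ, hγ⟩ : ∃ γ, ¬ w ≤ y γ := by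
        by_contra! hall
        exact hw0 (le_antisymm (h0.2 (by rintro _ ⟨γ, rfl⟩; exact hall γ)) hw)
      obtain ⟨α₀, hα₀⟩ := h γ
      exact ⟨y γ, h0.1 ⟨γ, rfl⟩, hγ, α₀, fun α hα β hβ =>
        (inf_le_inf_right _ (hp _ _)).trans (hα₀ α hα β hβ)⟩)
  exact ⟨l, fun w y α₀ h α hα => hl w y α₀
    (fun α hα β hβ => (inf_le_inf_right _ (hp _ _)).trans (h α hα β hβ)) α hα⟩

/-- Directedness allows the two summands to be taken at independent indices, so the infimum is taken
in each separately. -/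
theorem isGLB_range_add_self {Γ : Type w} [Preorder Γ] [IsDirectedOrder Γ] {y : Γ → X}
    (hy : Antitone y) (h0 : IsGLB (Set.range y) 0) :
    IsGLB (Set.range fun γ => y γ + y γ) 0 := by
  constructor
  · rintro _ ⟨γ, rfl⟩
    exact add_nonneg (h0.1 ⟨γ, rfl⟩) (h0.1 ⟨γ, rfl⟩)
  · intro z hz
    refine h0.2 ?_
    rintro _ ⟨γ₁, rfl⟩
    rw [← sub_nonpos]
    refine h0.2 ?_
    rintro _ ⟨γ₂, rfl⟩
    obtain ⟨γ, h₁, h₂⟩ := exists_ge_ge γ₁ γ₂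
    rw [sub_le_iff_le_add']
    exact (hz ⟨γ, rfl⟩).trans (add_le_add (hy h₁) (hy h₂))

end LatticeOrderedGroup

theorem mainTheorem6 (X : Type u) [AddCommGroup X] [Lattice X] [IsOrderedAddMonoid X]
    [Module ℝ X] [IsOrderedModule ℝ X] (hX : UniversallyComplete X) :
    UOComplete.{u, v} X := by
  intro A _ _ _ x hx
  obtain ⟨l₁, h₁⟩ := hx.exists_forall_abs_sub_inf_le hX posPart_nonneg abs_posPart_sub_posPart_le
  obtain ⟨l₂, h₂⟩ := hx.exists_forall_abs_sub_inf_le hX negPart_nonneg abs_negPart_sub_negPart_le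
  refine ⟨l₁ - l₂, fun w hw => ?_⟩
  obtain ⟨Γ, i₁, i₂, i₃, y, hy, h0, h⟩ := hx.exists_dominating hw
  refine ⟨Γ, i₁, i₂, i₃, fun γ => y γ + y γ, fun _ _ hab => add_le_add (hy hab) (hy hab),
    isGLB_range_add_self hy h0, fun γ => ?_⟩
  obtain ⟨α₀, hα₀⟩ := h γ
  refine ⟨α₀, fun α hα => ?_⟩
  rw [sub_zero, abs_of_nonneg (le_inf (abs_nonneg _) hw)]
  have h3 : |x α - (l₁ - l₂)| ≤ |(x α)⁺ - l₁| + |(x α)⁻ - l₂| := by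
    have h4 : x α - (l₁ - l₂) = ((x α)⁺ - l₁) + -((x α)⁻ - l₂) := by
      conv_lhs => rw [← posPart_sub_negPart (x α)]
      abel
    rw [h4, ← abs_neg ((x α)⁻ - l₂)]
    exact abs_add_le _ _
  exact (inf_le_inf_right _ h3).trans ((add_inf_le_inf_add_inf (abs_nonneg _) (abs_nonneg _)
    hw).trans (add_le_add (h₁ w _ α₀ hα₀ α hα) (h₂ w _ α₀ hα₀ α hα)))
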